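/- Let $b\in\mathbb R^2$ (receiver), $\lambda,\lambda_{I,m},\hat P_I,\tau\ge 0$ and $\alpha>2$. Let $\Phi=\{x_j\}$ (active IoT devices) and $\Phi_{I,m}=\{x'_{j'}\}$ (active incumbents on band $m$) be homogeneous Poisson point processes in the plane $\mathbb R^2$ with densities $\lambda$ and $\lambda_{I,m}$, let $h_i$, $(f_j)$, $(g_{j'})$ be i.i.d. fading gains with distribution $\mathrm{Exp}(1)$, and let $p_{i,b}$ be the distance from $b$ to a (possibly random) device $i$ in the plane. Assume that the location of device $i$, $h_i$, $\Phi$, $(f_j)$, $\Phi_{I,m}$ and $(g_{j'})$ are mutually independent. For a noise power $\hat P_N\ge 0$ put $$\mathrm{SINR}_{i,b,m}=\frac{h_i\,p_{i,b}^{-\alpha}}{\hat P_N+\sum_{j\in\Phi} f_j\,\|x_j-b\|^{-\alpha}+\sum_{j'\in\Phi_{I,m}}\hat P_I\,g_{j'}\,\|x'_{j'}-b\|^{-\alpha}}\in[0,\infty],$$ with $0^{-\alpha}=\infty$, $0\cdot\infty=0$, and $x/0=\infty$ for $x>0$. Then, if $\hat P_N=0$, almost surely $$\Pr(\mathrm{SINR}_{i,b,m}\ge\tau\mid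 p_{i,b})=\exp\left(-\epsilon_m\,\tau^{2/\alpha}\,p_{i,b}^2\right),\qquad \epsilon_m=\pi\left(\lambda+\hat P_I^{2/\alpha}\lambda_{I,m}\right)\frac{2\pi/\alpha}{\sin(2\pi/\alpha)}.$$ Moreover, along every sequence of noise powers $\hat P_N\ge0$ that tends to $0$, the conditional probabilities $\Pr(\mathrm{SINR}_{i,b,m}\ge\tau\mid p_{i,b})$ converge almost surely to the same expression. Finally, if $\hat P_I>0$, then $\hat P_I^{2/\alpha}\lambda_{I,m}\to\lambda_{I,m}$ as $\alpha\to\infty$. -/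

import Mathlib

open MeasureTheory ProbabilityTheory Filter Topology
open scoped ENNReal NNReal

/-- The Euclidean plane, with the Euclidean distance and Lebesgue measure. -/
abbrev Plane : Type := EuclideanSpace ℝ (Fin 2)

/-- A point process in `E` given by a measurable enumeration: `num ω ∈ ℕ ∪ {∞}` is the total
number of points, and the points are `pt k ω` for the indices `k < num ω`
(the values `pt k ω` with `k ≥ num ω` are not points of the process). -/
structure PointProcess (Ω E : Type*) [MeasurableSpace Ω] [MeasurableSpace E] where
  num : Ω → ℕ∞
  pt : ℕ → Ω → E
  measurable_num : Measurable num
  measurable_pt : ∀ k, Measurable (pt k)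

namespace PointProcess

variable {Ω E : Type*} [MeasurableSpace Ω] [MeasurableSpace E]

/-- The number of points of the process in the set `A`. -/
noncomputable def count (Φ : PointProcess Ω E) (A : Set E) (ω : Ω) : ℕ∞ :=
  Set.encard {k : ℕ | (k : ℕ∞) < Φ.num ω ∧ Φ.pt k ω ∈ A}

/-- The whole process as a single random element. -/
def toRandomElement (Φ : PointProcess Ω E) (ω : Ω) : ℕ∞ × (ℕ → E) :=
  (Φ.num ω, fun k => Φ.pt k ω)

end PointProcess

/-- `Φ` is a homogeneous Poisson point process in the plane with density `lam` (under `μ`): the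
number of points in a bounded Borel set `A` is Poisson with mean `lam * |A|`, and the numbers of
points in finitely many pairwise disjoint bounded Borel sets are independent. -/
structure IsHPPP {Ω : Type*} [MeasurableSpace Ω] (Φ : PointProcess Ω Plane) (lam : ℝ≥0)
    (μ : Measure Ω) : Prop where
  hasLaw_count : ∀ A : Set Plane, MeasurableSet A → Bornology.IsBounded A →
    HasLaw (Φ.count A)
      ((poissonMeasure (lam * (volume A).toNNReal)).map (Nat.cast : ℕ → ℕ∞)) μ
  iIndepFun_count : ∀ (n : ℕ) (A : Fin n → Set Plane), (∀ i, MeasurableSet (A i)) →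
    (∀ i, Bornology.IsBounded (A i)) → Pairwise (fun i j => Disjoint (A i) (A j)) →
    iIndepFun (fun i => Φ.count (A i)) μ

/-- The total power received at `b` from the points `x_k` of `Φ`, all transmitting with power `P`,
with fading gains `f_k` and path loss `dist(x_k, b) ^ (-α)`. -/
noncomputable def interference {Ω : Type*} [MeasurableSpace Ω] (P : ℝ≥0) (α : ℝ) (b : Plane)
    (Φ : PointProcess Ω Plane) (f : ℕ → Ω → ℝ) (ω : Ω) : ℝ≥0∞ :=
  ∑' k : ℕ, if (k : ℕ∞) < Φ.num ω then
    (P : ℝ≥0∞) * ENNReal.ofReal (f k ω) * edist (Φ.pt k ω) b ^ (-α) else 0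

/-- The signal to interference and noise ratio at the receiver `b` of a device at `y` with fading
gain `h`; `PN` and `PI` are the noise power and the power of the incumbents (`ΦI`, with fading
gains `g`), relative to the common power of the IoT devices (`Φ`, with fading gains `f`). -/
noncomputable def sinr {Ω : Type*} [MeasurableSpace Ω] (PN PI : ℝ≥0) (α : ℝ) (b : Plane)
    (y : Ω → Plane) (h : Ω → ℝ) (Φ : PointProcess Ω Plane) (f : ℕ → Ω → ℝ)
    (ΦI : PointProcess Ω Plane) (g : ℕ → Ω → ℝ) (ω : Ω) : ℝ≥0∞ :=
  (ENNReal.ofReal (h ω) * edist (y ω) b ^ (-α)) /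
    ((PN : ℝ≥0∞) + interference 1 α b Φ f ω + interference PI α b ΦI g ω)

/-- The constant `ε = π (λ + P_I ^ (2/α) λ_I) (2π/α) / sin (2π/α)`. -/
noncomputable def interferenceCoeff (lam lamI PI : ℝ≥0) (α : ℝ) : ℝ :=
  Real.pi * ((lam : ℝ) + (PI : ℝ) ^ (2 / α) * (lamI : ℝ)) *
    ((2 * Real.pi / α) / Real.sin (2 * Real.pi / α))

/-!
Write `D` for the noise plus the two interferences and `ρ` for the distance from the device to the
receiver. Since `SINR ≥ τ` means `h ≥ τ ρ ^ α D` and `h` is a standard exponential variable that is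
independent of `(ρ, D)`, the conditional probability is the Laplace transform of `D` at
`s = τ ρ ^ α`, and it splits into a factor `exp (-s P_N)` and one factor for each interference. An
interference is the shot noise of a marked Poisson process, so by the Laplace functional its Laplace
transform is `exp (-λ ∫ E (1 - exp (-s P m ‖x - b‖ ^ (-α))) dx)`, where `m` is a fading gain. The
integral is `π Γ(1 - 2/α) (s P) ^ (2/α) E m ^ (2/α)`, and `E m ^ (2/α) = Γ(1 + 2/α)`; by the
reflection formula the two values of `Γ` combine to `(2π/α) / sin (2π/α)`. All this takes place in
`[0, ∞]`; the interference must be shown to be finite almost surely, because for `ρ = 0` and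
`D = ∞` the ratio `h ρ ^ (-α) / D` is `∞ / ∞ = 0`, while `τ ρ ^ α D ≤ h` holds.
-/

/-- The function `x ↦ exp (-x)` on `[0, ∞]`, with value `0` at `∞`: the integrand of the Laplace
transform of a `[0, ∞]`-valued random variable. -/
noncomputable def expNeg (x : ℝ≥0∞) : ℝ≥0∞ := EReal.exp (-(x : EReal))

@[simp] lemma expNeg_zero : expNeg 0 = 1 := by simp [expNeg]

@[simp] lemma expNeg_top : expNeg ∞ = 0 := by simp [expNeg]

lemma expNeg_add (x y : ℝ≥0∞) : expNeg (x + y) = expNeg x * expNeg y := by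
  rw [expNeg, expNeg, expNeg, ← EReal.exp_add, EReal.coe_ennreal_add, EReal.neg_add, sub_eq_add_neg]
  · left; simp
  · right; simp

lemma expNeg_sum {ι : Type*} (s : Finset ι) (u : ι → ℝ≥0∞) :
    expNeg (∑ i ∈ s, u i) = ∏ i ∈ s, expNeg (u i) := by
  induction s using Finset.cons_induction with
  | empty => simp
  | cons a s ha ih => rw [Finset.sum_cons, Finset.prod_cons, expNeg_add, ih]

lemma expNeg_nat_mul (n : ℕ) (c : ℝ≥0∞) : expNeg (n * c) = expNeg c ^ n := by
  simpa using expNeg_sum (Finset.range n) fun _ => c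

lemma expNeg_ofReal {x : ℝ} (hx : 0 ≤ x) :
    expNeg (ENNReal.ofReal x) = ENNReal.ofReal (Real.exp (-x)) := by
  rw [expNeg, EReal.coe_ennreal_ofReal, max_eq_left hx, ← EReal.coe_neg, EReal.exp_coe]

lemma antitone_expNeg : Antitone expNeg := fun _ _ h =>
  EReal.exp_monotone (EReal.neg_le_neg_iff.2 (EReal.coe_ennreal_le_coe_ennreal_iff.2 h))

lemma expNeg_le_one (x : ℝ≥0∞) : expNeg x ≤ 1 := by
  simpa using antitone_expNeg (zero_le (a := x))

lemma expNeg_ne_top (x : ℝ≥0∞) : expNeg x ≠ ∞ := ne_top_of_le_ne_top ENNReal.one_ne_top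
  (expNeg_le_one x)

@[fun_prop] lemma continuous_expNeg : Continuous expNeg :=
  ENNReal.continuous_exp.comp (continuous_neg.comp continuous_coe_ennreal_ereal)

@[fun_prop] lemma measurable_expNeg : Measurable expNeg := continuous_expNeg.measurable

/-- The inverse `q ↦ -log q` of `expNeg`, truncated at `0` for `q > 1`. It turns a product of
Laplace transforms into the exponential of a sum. -/
noncomputable def negLog (q : ℝ≥0∞) : ℝ≥0∞ := (-ENNReal.log q).toENNReal

@[simp] lemma negLog_one : negLog 1 = 0 := by simp [negLog]

@[fun_prop] lemma measurable_negLog : Measurable negLog := by unfold negLog; fun_prop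

lemma expNeg_negLog {q : ℝ≥0∞} (hq : q ≤ 1) : expNeg (negLog q) = q := by
  have h : 0 ≤ -ENNReal.log q := by simpa [EReal.le_neg] using hq
  rw [expNeg, negLog, EReal.coe_toENNReal h, neg_neg, ENNReal.exp_log]

section LaplaceTransform

variable {Ω : Type*} [MeasurableSpace Ω] {μ : Measure Ω}

lemma tendsto_lintegral_expNeg [IsFiniteMeasure μ] {X : ℕ → Ω → ℝ≥0∞} {Y : Ω → ℝ≥0∞}
    (hX : ∀ n, Measurable (X n)) (hlim : ∀ ω, Tendsto (fun n => X n ω) atTop (𝓝 (Y ω))) :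
    Tendsto (fun n => ∫⁻ ω, expNeg (X n ω) ∂μ) atTop (𝓝 (∫⁻ ω, expNeg (Y ω) ∂μ)) :=
  tendsto_lintegral_of_dominated_convergence (fun _ => 1) (fun n => by fun_prop)
    (fun _ => ae_of_all _ fun _ => expNeg_le_one _) (by simp)
    (ae_of_all _ fun ω => (continuous_expNeg.tendsto _).comp (hlim ω))

lemma lintegral_expNeg_le_one [IsProbabilityMeasure μ] (X : Ω → ℝ≥0∞) :
    ∫⁻ ω, expNeg (X ω) ∂μ ≤ 1 :=
  (lintegral_mono fun _ => expNeg_le_one _).trans_eq (by simp)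

lemma lintegral_expNeg_tsum_of_iIndepFun {X : ℕ → Ω → ℝ≥0∞} (hX : ∀ k, Measurable (X k))
    (hX_indep : iIndepFun X μ) :
    ∫⁻ ω, expNeg (∑' k, X k ω) ∂μ = expNeg (∑' k, negLog (∫⁻ ω, expNeg (X k ω) ∂μ)) := by
  have : IsProbabilityMeasure μ := hX_indep.isProbabilityMeasure
  have h_partial (n : ℕ) : ∫⁻ ω, expNeg (∑ k ∈ Finset.range n, X k ω) ∂μ
      = expNeg (∑ k ∈ Finset.range n, negLog (∫⁻ ω, expNeg (X k ω) ∂μ)) := by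
    simp_rw [expNeg_sum, expNeg_negLog (lintegral_expNeg_le_one _)]
    exact lintegral_prod_eq_prod_lintegral_of_indepFun _ _
      (hX_indep.comp (fun _ => expNeg) fun _ => measurable_expNeg) fun k => by fun_prop
  refine tendsto_nhds_unique (tendsto_lintegral_expNeg (fun n => by fun_prop)
    fun ω => ENNReal.tendsto_nat_tsum fun k => X k ω) ?_
  simp_rw [h_partial]
  exact (continuous_expNeg.tendsto _).comp (ENNReal.tendsto_nat_tsum _)

-- For `s > 0`, the variable `exp (-s X)` vanishes on `{X = ∞}`, so `E exp (-s X) ≤ P (X < ∞)`.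
lemma ae_lt_top_of_tendsto_lintegral_expNeg_mul [IsProbabilityMeasure μ] {X : Ω → ℝ≥0∞}
    (hX : Measurable X)
    (hlim : Tendsto (fun s => ∫⁻ ω, expNeg (s * X ω) ∂μ) (𝓝[>] 0) (𝓝 1)) :
    ∀ᵐ ω ∂μ, X ω < ∞ := by
  have h_meas : MeasurableSet {ω | X ω < ∞} := hX measurableSet_Iio
  refine (mem_ae_iff_prob_eq_one h_meas).2 (le_antisymm prob_le_one (le_of_tendsto hlim ?_))
  filter_upwards [self_mem_nhdsWithin] with s hs
  rw [← lintegral_indicator_one h_meas]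
  refine lintegral_mono fun ω => ?_
  by_cases hω : X ω < ∞
  · simpa [hω] using expNeg_le_one _
  · simp [not_lt_top_iff.1 hω, ENNReal.mul_top (ne_of_gt hs)]

end LaplaceTransform

section Exponential

variable {r : ℝ}

lemma ae_pos_expMeasure (hr : 0 < r) : ∀ᵐ x ∂expMeasure r, 0 < x := by
  have := isProbabilityMeasure_expMeasure hr
  have h_zero : expMeasure r (Set.Iic 0) = 0 := by
    rw [← ofReal_cdf, cdf_expMeasure_eq hr]
    simp
  simpa [ae_iff, Set.Iic_def] using h_zero

lemma expMeasure_setOf_ofReal_lt (hr : 0 < r) (t : ℝ≥0∞) :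
    expMeasure r {x | ENNReal.ofReal x < t} = 1 - expNeg (ENNReal.ofReal r * t) := by
  have := isProbabilityMeasure_expMeasure hr
  induction t with
  | top => simp [ENNReal.mul_top, hr]
  | coe t =>
    rcases eq_or_ne t 0 with rfl | ht
    · simp
    have h_set : {x : ℝ | ENNReal.ofReal x < t} = Set.Iio (t : ℝ) := by
      ext x
      simp [← ENNReal.ofReal_coe_nnreal, ENNReal.ofReal_lt_ofReal_iff, pos_iff_ne_zero.2 ht]
    have h_atom : expMeasure r {(t : ℝ)} = 0 :=
      withDensity_absolutelyContinuous _ _ Real.volume_singleton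
    rw [h_set, measure_congr (Iio_ae_eq_Iic' h_atom), ← ofReal_cdf, cdf_expMeasure_eq hr,
      if_pos t.coe_nonneg, ENNReal.ofReal_sub _ (by positivity), ENNReal.ofReal_one,
      ← ENNReal.ofReal_coe_nnreal, ← ENNReal.ofReal_mul hr.le, expNeg_ofReal (by positivity)]

lemma expMeasure_setOf_le_ofReal (hr : 0 < r) (t : ℝ≥0∞) :
    expMeasure r {x | t ≤ ENNReal.ofReal x} = expNeg (ENNReal.ofReal r * t) := by
  have := isProbabilityMeasure_expMeasure hr
  have h_compl : {x | t ≤ ENNReal.ofReal x} = {x | ENNReal.ofReal x < t}ᶜ := by ext; simp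
  rw [h_compl, prob_compl_eq_one_sub (measurableSet_lt (by fun_prop) measurable_const),
    expMeasure_setOf_ofReal_lt hr, ENNReal.sub_sub_cancel ENNReal.one_ne_top (expNeg_le_one _)]

-- Up to a constant factor, `x ↦ x ^ p * exp (-r x)` is the density of a gamma distribution.
lemma lintegral_rpow_expMeasure (hr : 0 < r) {p : ℝ} (hp : -1 < p) :
    ∫⁻ x, ENNReal.ofReal x ^ p ∂expMeasure r
      = ENNReal.ofReal (r ^ (-p) * Real.Gamma (p + 1)) := by
  have hΓ : 0 < Real.Gamma (p + 1) := Real.Gamma_pos_of_pos (by linarith)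
  have h_meas : Measurable (exponentialPDF r) :=
    (measurable_exponentialPDFReal r).ennreal_ofReal
  have h_density : ∀ᵐ x : ℝ, exponentialPDF r x * ENNReal.ofReal x ^ p
      = ENNReal.ofReal (r ^ (-p) * Real.Gamma (p + 1)) * gammaPDF (p + 1) r x := by
    filter_upwards [Measure.ae_ne volume (0 : ℝ)] with x hx
    rcases hx.lt_or_gt with hx | hx
    · simp [exponentialPDF_of_neg hx, gammaPDF_of_neg hx]
    · rw [exponentialPDF_of_nonneg hx.le, gammaPDF_of_nonneg hx.le, ENNReal.ofReal_rpow_of_pos hx,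
        ← ENNReal.ofReal_mul (by positivity), ← ENNReal.ofReal_mul (by positivity),
        Real.rpow_neg hr.le, Real.rpow_add hr, Real.rpow_one, add_sub_cancel_right]
      congr 1
      field_simp
  calc ∫⁻ x, ENNReal.ofReal x ^ p ∂expMeasure r
    _ = ∫⁻ x, exponentialPDF r x * ENNReal.ofReal x ^ p :=
      lintegral_withDensity_eq_lintegral_mul _ h_meas (by fun_prop)
    _ = ENNReal.ofReal (r ^ (-p) * Real.Gamma (p + 1)) * ∫⁻ x, gammaPDF (p + 1) r x := by
      rw [lintegral_congr_ae h_density, lintegral_const_mul' _ _ ENNReal.ofReal_ne_top]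
    _ = ENNReal.ofReal (r ^ (-p) * Real.Gamma (p + 1)) := by
      rw [lintegral_gammaPDF_eq_one (by linarith) hr, mul_one]

end Exponential

section PathLoss

lemma lt_mul_rpow_neg_iff {t c ρ : ℝ≥0∞} {α : ℝ} (hα : 0 < α) (ht : t ≠ 0) (ht' : t ≠ ∞) :
    t < c * ρ ^ (-α) ↔ ρ < (c / t) ^ α⁻¹ := by
  rw [ENNReal.lt_rpow_inv_iff hα, ENNReal.rpow_neg, ← div_eq_mul_inv]
  rcases eq_or_ne (ρ ^ α) ∞ with h_top | h_top
  · simp [h_top]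
  · rw [ENNReal.lt_div_iff_mul_lt (.inr ht') (.inl h_top), mul_comm,
      ENNReal.lt_div_iff_mul_lt (.inl ht) (.inl ht')]

variable {E : Type*} [NormedAddCommGroup E] [NormedSpace ℝ E] [FiniteDimensional ℝ E]
  [Nontrivial E] [MeasurableSpace E] [BorelSpace E] (ν : Measure E) [ν.IsAddHaarMeasure]

lemma addHaar_eball (x : E) (r : ℝ≥0∞) :
    ν (Metric.eball x r) = r ^ Module.finrank ℝ E * ν (Metric.ball 0 1) := by
  induction r with
  | top =>
    have h_ball : ν (Metric.ball 0 1) ≠ 0 := (Metric.measure_ball_pos ν 0 one_pos).ne'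
    simp [Metric.eball_top, ENNReal.top_pow Module.finrank_pos.ne', ENNReal.top_mul h_ball,
      measure_univ_of_isAddLeftInvariant]
  | coe r =>
    rw [← ENNReal.ofReal_coe_nnreal, Metric.eball_ofReal, Measure.addHaar_ball ν x r.coe_nonneg,
      ENNReal.ofReal_pow r.coe_nonneg]

-- With `1 - exp (-w)` written as the probability that a standard exponential variable `t` is less
-- than `w`, the points `x` that qualify for a given value of `t` form a ball.
lemma lintegral_one_sub_expNeg_mul_edist_rpow {α : ℝ} (hα : Module.finrank ℝ E < α) (b : E)
    (c : ℝ≥0∞) :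
    ∫⁻ x, (1 - expNeg (c * edist x b ^ (-α))) ∂ν
      = c ^ (Module.finrank ℝ E / α) *
        ENNReal.ofReal (Real.Gamma (1 - Module.finrank ℝ E / α)) * ν (Metric.ball 0 1) := by
  have := isProbabilityMeasure_expMeasure one_pos
  have hα0 : 0 < α := (Nat.cast_nonneg _).trans_lt hα
  set δ : ℝ := Module.finrank ℝ E / α with hδ
  have hδ1 : δ < 1 := (div_lt_one hα0).2 hα
  have h_meas : MeasurableSet {p : E × ℝ | ENNReal.ofReal p.2 < c * edist p.1 b ^ (-α)} :=
    measurableSet_lt (by fun_prop) (by fun_prop)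
  have h_slice : ∀ᵐ t ∂expMeasure 1, ν {x | ENNReal.ofReal t < c * edist x b ^ (-α)}
      = c ^ δ * ν (Metric.ball 0 1) * ENNReal.ofReal t ^ (-δ) := by
    filter_upwards [ae_pos_expMeasure one_pos] with t ht
    have h_ball : {x | ENNReal.ofReal t < c * edist x b ^ (-α)}
        = Metric.eball b ((c / ENNReal.ofReal t) ^ α⁻¹) := by
      ext x
      exact lt_mul_rpow_neg_iff hα0 (by simpa) ENNReal.ofReal_ne_top
    rw [h_ball, addHaar_eball, ← ENNReal.rpow_natCast, ← ENNReal.rpow_mul, inv_mul_eq_div, ← hδ,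
      ENNReal.div_rpow_of_nonneg _ _ (by positivity), ENNReal.rpow_neg, div_eq_mul_inv,
      mul_right_comm]
  calc ∫⁻ x, (1 - expNeg (c * edist x b ^ (-α))) ∂ν
    _ = ∫⁻ x, expMeasure 1 {t | ENNReal.ofReal t < c * edist x b ^ (-α)} ∂ν := by
      simp_rw [expMeasure_setOf_ofReal_lt one_pos, ENNReal.ofReal_one, one_mul]
    _ = ∫⁻ t, ν {x | ENNReal.ofReal t < c * edist x b ^ (-α)} ∂expMeasure 1 :=
      (Measure.prod_apply h_meas).symm.trans (Measure.prod_apply_symm h_meas)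
    _ = c ^ δ * ν (Metric.ball 0 1) * ENNReal.ofReal (Real.Gamma (1 - δ)) := by
      rw [lintegral_congr_ae h_slice, lintegral_const_mul _ (by fun_prop),
        lintegral_rpow_expMeasure one_pos (by linarith), Real.one_rpow, one_mul, neg_add_eq_sub]
    _ = c ^ δ * ENNReal.ofReal (Real.Gamma (1 - δ)) * ν (Metric.ball 0 1) := mul_right_comm _ _ _

end PathLoss

lemma Gamma_add_one_mul_Gamma_one_sub {x : ℝ} (hx : x ≠ 0) :
    Real.Gamma (x + 1) * Real.Gamma (1 - x) = Real.pi * x / Real.sin (Real.pi * x) := by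
  rw [Real.Gamma_add_one hx, mul_assoc, Real.Gamma_mul_Gamma_one_sub]
  ring

section Independence

variable {Ω β γ : Type*} {mΩ : MeasurableSpace Ω} [mβ : MeasurableSpace β] [MeasurableSpace γ]
  {μ : Measure Ω} {X : Ω → β} {Z : Ω → γ}

lemma lintegral_prodMk_of_indepFun [IsFiniteMeasure μ] (hX : Measurable X) (hZ : Measurable Z)
    (h_indep : IndepFun X Z μ) {F : β × γ → ℝ≥0∞} (hF : Measurable F) :
    ∫⁻ ω, F (X ω, Z ω) ∂μ = ∫⁻ ω, ∫⁻ z, F (X ω, z) ∂μ.map Z ∂μ := by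
  rw [← lintegral_map hF (hX.prodMk hZ),
    (indepFun_iff_map_prod_eq_prod_map_map hX.aemeasurable hZ.aemeasurable).1 h_indep,
    lintegral_prod _ hF.aemeasurable, lintegral_map hF.lintegral_prod_right' hX]

lemma indepFun_of_iIndep_of_disjoint {ι : Type*} {m : ι → MeasurableSpace Ω}
    (hm : ∀ i, m i ≤ mΩ) (h_indep : iIndep m μ) {S T : Set ι} (hST : Disjoint S T)
    (hX : Measurable[⨆ i ∈ S, m i] X) (hZ : Measurable[⨆ i ∈ T, m i] Z) : IndepFun X Z μ :=
  indep_of_indep_of_le (indep_iSup_of_disjoint hm h_indep hST) hX.comap_le hZ.comap_le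

lemma condProb_ae_eq_of_indepFun [StandardBorelSpace γ] [Nonempty γ] [IsFiniteMeasure μ]
    (hX : Measurable X) (hZ : Measurable Z) (h_indep : IndepFun X Z μ) {S : Set (β × γ)}
    (hS : MeasurableSet S) :
    μ⟦{ω | (X ω, Z ω) ∈ S} | mβ.comap X⟧ =ᵐ[μ] fun ω => μ.real {ω' | (X ω, Z ω') ∈ S} := by
  have h_distrib : condDistrib Z X μ =ᵐ[μ.map X] Kernel.const β (μ.map Z) := by
    refine condDistrib_ae_eq_of_measure_eq_compProd X hZ.aemeasurable ?_
    rw [Measure.compProd_const]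
    exact (indepFun_iff_map_prod_eq_prod_map_map hX.aemeasurable hZ.aemeasurable).1 h_indep
  have h_cond := condExp_prod_ae_eq_integral_condDistrib (μ := μ) hX hZ.aemeasurable
    (stronglyMeasurable_const.indicator hS)
    ((integrable_const (1 : ℝ)).indicator (hX.prodMk hZ hS))
  filter_upwards [h_cond, ae_of_ae_map hX.aemeasurable h_distrib] with ω hω h_const
  have h_slice : MeasurableSet {z | (X ω, z) ∈ S} := measurable_prodMk_left hS
  calc _ = ∫ z, S.indicator (fun _ => (1 : ℝ)) (X ω, z) ∂condDistrib Z X μ (X ω) := hω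
    _ = ∫ z, {z | (X ω, z) ∈ S}.indicator 1 z ∂μ.map Z := by rw [h_const, Kernel.const_apply]; rfl
    _ = μ.real {ω' | (X ω, Z ω') ∈ S} := by
      rw [integral_indicator_one h_slice, map_measureReal_apply hZ h_slice]; rfl

end Independence

lemma measurableSet_natCast_lt {Ω : Type*} [MeasurableSpace Ω] {N : Ω → ℕ∞} (hN : Measurable N)
    (k : ℕ) : MeasurableSet {ω | (k : ℕ∞) < N ω} :=
  hN (.of_discrete (s := Set.Ioi (k : ℕ∞)))

namespace PointProcess

variable {Ω E M : Type*} [MeasurableSpace Ω] [MeasurableSpace E] [MeasurableSpace M]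

/-- The random counting measure of a point process. -/
noncomputable def toMeasure (Φ : PointProcess Ω E) (ω : Ω) : Measure E :=
  Measure.sum fun k : ℕ => if (k : ℕ∞) < Φ.num ω then Measure.dirac (Φ.pt k ω) else 0

lemma lintegral_toMeasure (Φ : PointProcess Ω E) (ω : Ω) {u : E → ℝ≥0∞} (hu : Measurable u) :
    ∫⁻ x, u x ∂Φ.toMeasure ω = ∑' k : ℕ, if (k : ℕ∞) < Φ.num ω then u (Φ.pt k ω) else 0 := by
  rw [toMeasure, lintegral_sum_measure]
  congr 1 with k
  split_ifs
  · exact lintegral_dirac' _ hu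
  · simp

lemma toMeasure_apply (Φ : PointProcess Ω E) (ω : Ω) {A : Set E} (hA : MeasurableSet A) :
    Φ.toMeasure ω A = (Φ.count A ω : ℝ≥0∞) := by
  rw [← lintegral_indicator_one hA, lintegral_toMeasure _ _ (measurable_one.indicator hA), count,
    ← ENNReal.tsum_set_one, tsum_subtype _ (fun _ => (1 : ℝ≥0∞))]
  congr 1 with k
  by_cases h_num : (k : ℕ∞) < Φ.num ω <;> by_cases h_pt : Φ.pt k ω ∈ A <;> simp [h_num, h_pt]

lemma measurable_toMeasure (Φ : PointProcess Ω E) : Measurable Φ.toMeasure := by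
  refine Measure.measurable_of_measurable_coe _ fun A hA => ?_
  simp_rw [← lintegral_indicator_one hA, lintegral_toMeasure _ _ (measurable_one.indicator hA)]
  exact Measurable.tsum fun k => Measurable.ite (measurableSet_natCast_lt Φ.measurable_num k)
    ((measurable_one.indicator hA).comp (Φ.measurable_pt k)) measurable_const

lemma measurable_setLIntegral_toMeasure (Φ : PointProcess Ω E) {S : Set E} (hS : MeasurableSet S)
    {u : E → ℝ≥0∞} (hu : Measurable u) : Measurable fun ω => ∫⁻ x in S, u x ∂Φ.toMeasure ω := by
  simp_rw [← lintegral_indicator hS]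
  exact (Measure.measurable_lintegral (hu.indicator hS)).comp Φ.measurable_toMeasure

lemma measurable_toRandomElement (Φ : PointProcess Ω E) : Measurable Φ.toRandomElement :=
  Φ.measurable_num.prodMk (measurable_pi_lambda _ Φ.measurable_pt)

/-- A point process together with a sequence of marks, as a single random element; the mark `f k`
belongs to the point `Φ.pt k`. -/
def marked (Φ : PointProcess Ω E) (f : ℕ → Ω → M) (ω : Ω) : (ℕ∞ × (ℕ → E)) × (ℕ → M) :=
  (Φ.toRandomElement ω, fun k => f k ω)

lemma measurable_marked (Φ : PointProcess Ω E) {f : ℕ → Ω → M} (hf : ∀ k, Measurable (f k)) :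
    Measurable (Φ.marked f) :=
  Φ.measurable_toRandomElement.prodMk (measurable_pi_lambda _ hf)

end PointProcess

section ShotNoise

variable {E M : Type*}

/-- The shot noise of a marked configuration `p`, as produced by `PointProcess.marked`: the sum of
the responses `u x m` over its points `x`, with marks `m`. -/
noncomputable def shotNoise (u : E → M → ℝ≥0∞) (p : (ℕ∞ × (ℕ → E)) × (ℕ → M)) : ℝ≥0∞ :=
  ∑' k : ℕ, if (k : ℕ∞) < p.1.1 then u (p.1.2 k) (p.2 k) else 0

lemma const_mul_shotNoise (c : ℝ≥0∞) (u : E → M → ℝ≥0∞) (p : (ℕ∞ × (ℕ → E)) × (ℕ → M)) :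
    c * shotNoise u p = shotNoise (fun x m => c * u x m) p := by
  simp_rw [shotNoise, ← ENNReal.tsum_mul_left, mul_ite, mul_zero]

lemma measurable_shotNoise [MeasurableSpace E] [MeasurableSpace M] {u : E → M → ℝ≥0∞}
    (hu : Measurable u.uncurry) : Measurable (shotNoise u) :=
  Measurable.tsum fun k => Measurable.ite
    (measurableSet_natCast_lt (measurable_fst.comp measurable_fst) k)
    (hu.comp (f := fun p : (ℕ∞ × (ℕ → E)) × (ℕ → M) => (p.1.2 k, p.2 k)) (by fun_prop))
    measurable_const

end ShotNoise

lemma lintegral_expNeg_mul_poissonMeasure (r : ℝ≥0) (c : ℝ≥0∞) :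
    ∫⁻ n, expNeg (n * c) ∂poissonMeasure r = expNeg (r * (1 - expNeg c)) := by
  obtain ⟨q, hq⟩ : ∃ q : ℝ≥0, expNeg c = q := ⟨_, (ENNReal.coe_toNNReal (expNeg_ne_top c)).symm⟩
  have hq1 : q ≤ 1 := by exact_mod_cast hq ▸ expNeg_le_one c
  have h_term (n : ℕ) : ENNReal.ofReal (Real.exp (-r) * r ^ n / n.factorial) * expNeg (n * c)
      = ENNReal.ofReal (Real.exp (-r) * ((r * q : ℝ) ^ n / n.factorial)) := by
    rw [expNeg_nat_mul, hq, ← ENNReal.ofReal_coe_nnreal, ← ENNReal.ofReal_pow (by positivity),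
      ← ENNReal.ofReal_mul (by positivity)]
    congr 1
    ring
  have h_sum : HasSum (fun n : ℕ => Real.exp (-r) * ((r * q : ℝ) ^ n / n.factorial))
      (Real.exp (-(r * (1 - q)))) := by
    have := (NormedSpace.expSeries_div_hasSum_exp (r * q : ℝ)).mul_left (Real.exp (-r))
    rwa [← Real.exp_eq_exp_ℝ, ← Real.exp_add, show -(r : ℝ) + r * q = -(r * (1 - q)) by ring]
      at this
  have h_exponent : (r : ℝ≥0∞) * (1 - q) = ENNReal.ofReal (r * (1 - q)) := by
    rw [← ENNReal.coe_one, ← ENNReal.coe_sub, ← ENNReal.coe_mul, ← ENNReal.ofReal_coe_nnreal,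
      NNReal.coe_mul, NNReal.coe_sub hq1, NNReal.coe_one]
  rw [poissonMeasure, lintegral_sum_measure]
  simp_rw [lintegral_smul_measure, lintegral_dirac, smul_eq_mul, h_term]
  rw [← ENNReal.ofReal_tsum_of_nonneg (fun n => by positivity) h_sum.summable, h_sum.tsum_eq, hq,
    h_exponent, expNeg_ofReal (mul_nonneg r.coe_nonneg (sub_nonneg.2 (mod_cast hq1)))]

lemma tendsto_setLIntegral_of_monotone {E : Type*} [MeasurableSpace E] (m : Measure E)
    {S : ℕ → Set E} (hS : ∀ n, MeasurableSet (S n)) (hS_mono : Monotone S)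
    (hS_univ : ⋃ n, S n = Set.univ) {v : ℕ → E → ℝ≥0∞} {u : E → ℝ≥0∞}
    (hv : ∀ n, Measurable (v n)) (hv_mono : Monotone v)
    (hlim : ∀ x, Tendsto (fun n => v n x) atTop (𝓝 (u x))) :
    Tendsto (fun n => ∫⁻ x in S n, v n x ∂m) atTop (𝓝 (∫⁻ x, u x ∂m)) := by
  simp_rw [← lintegral_indicator (hS _)]
  refine lintegral_tendsto_of_tendsto_of_monotone (fun n => ((hv n).indicator (hS n)).aemeasurable)
    (ae_of_all _ fun x i j hij => ?_) (ae_of_all _ fun x => ?_)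
  · exact (Set.indicator_le_indicator_of_subset (hS_mono hij) (fun _ => zero_le) x).trans
      (Set.indicator_le_indicator (hv_mono hij x))
  · obtain ⟨N, hN⟩ := Set.iUnion_eq_univ_iff.1 hS_univ x
    refine (hlim x).congr' ?_
    filter_upwards [eventually_ge_atTop N] with n hn
    rw [Set.indicator_of_mem (hS_mono hn hN)]

namespace IsHPPP

variable {Ω : Type*} [MeasurableSpace Ω] {μ : Measure Ω} {Φ : PointProcess Ω Plane} {lam : ℝ≥0}

lemma iIndepFun_count_of_finite (hΦ : IsHPPP Φ lam μ) {ι : Type*} [Finite ι]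
    {A : ι → Set Plane} (hA : ∀ i, MeasurableSet (A i)) (hb : ∀ i, Bornology.IsBounded (A i))
    (hd : Pairwise (Function.onFun Disjoint A)) : iIndepFun (fun i => Φ.count (A i)) μ := by
  let e := Finite.equivFin ι
  simpa using (hΦ.iIndepFun_count _ (A ∘ e.symm) (fun _ => hA _) (fun _ => hb _)
    (hd.comp_of_injective e.symm.injective)).precomp e.injective

lemma lintegral_expNeg_mul_toMeasure (hΦ : IsHPPP Φ lam μ) {A : Set Plane}
    (hA : MeasurableSet A) (hb : Bornology.IsBounded A) (c : ℝ≥0∞) :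
    ∫⁻ ω, expNeg (c * Φ.toMeasure ω A) ∂μ = expNeg (lam * ((1 - expNeg c) * volume A)) := by
  have h_law := hΦ.hasLaw_count A hA hb
  have h_meas : Measurable fun n : ℕ∞ => expNeg ((n : ℝ≥0∞) * c) := .of_discrete
  calc ∫⁻ ω, expNeg (c * Φ.toMeasure ω A) ∂μ
    _ = ∫⁻ ω, expNeg ((Φ.count A ω : ℝ≥0∞) * c) ∂μ := by
      simp_rw [Φ.toMeasure_apply _ hA, mul_comm c]
    _ = ∫⁻ n, expNeg ((n : ℝ≥0∞) * c) ∂poissonMeasure (lam * (volume A).toNNReal) := by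
      rw [← lintegral_map' h_meas.aemeasurable h_law.aemeasurable, h_law.map_eq,
        lintegral_map h_meas .of_discrete]
      simp_rw [ENat.toENNReal_coe]
    _ = expNeg (lam * ((1 - expNeg c) * volume A)) := by
      rw [lintegral_expNeg_mul_poissonMeasure, ENNReal.coe_mul,
        ENNReal.coe_toNNReal hb.measure_lt_top.ne, mul_assoc, mul_comm (volume A)]

lemma lintegral_expNeg_sum_mul_toMeasure (hΦ : IsHPPP Φ lam μ) {ι : Type*} [Fintype ι]
    {A : ι → Set Plane} (hA : ∀ i, MeasurableSet (A i)) (hb : ∀ i, Bornology.IsBounded (A i))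
    (hd : Pairwise (Function.onFun Disjoint A)) (c : ι → ℝ≥0∞) :
    ∫⁻ ω, expNeg (∑ i, c i * Φ.toMeasure ω (A i)) ∂μ
      = expNeg (lam * ∑ i, (1 - expNeg (c i)) * volume (A i)) := by
  have h_indep : iIndepFun (fun i ω => expNeg (c i * Φ.toMeasure ω (A i))) μ := by
    simp_rw [Φ.toMeasure_apply _ (hA _)]
    exact (hΦ.iIndepFun_count_of_finite hA hb hd).comp
      (fun i (n : ℕ∞) => expNeg (c i * n)) fun _ => .of_discrete
  have h_meas (i : ι) : Measurable fun ω => expNeg (c i * Φ.toMeasure ω (A i)) :=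
    measurable_expNeg.comp
      (((Measure.measurable_coe (hA i)).comp Φ.measurable_toMeasure).const_mul _)
  simp_rw [expNeg_sum]
  rw [lintegral_prod_eq_prod_lintegral_of_indepFun _ _ h_indep h_meas, Finset.mul_sum, expNeg_sum]
  exact Finset.prod_congr rfl fun i _ => hΦ.lintegral_expNeg_mul_toMeasure (hA i) (hb i) _

lemma lintegral_expNeg_setLIntegral_simpleFunc (hΦ : IsHPPP Φ lam μ) {S : Set Plane}
    (hS : MeasurableSet S) (hb : Bornology.IsBounded S) (v : SimpleFunc Plane ℝ≥0∞) :
    ∫⁻ ω, expNeg (∫⁻ x in S, v x ∂Φ.toMeasure ω) ∂μ =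
      expNeg (lam * ∫⁻ x in S, (1 - expNeg (v x))) := by
  let A : v.range → Set Plane := fun r => v ⁻¹' {r.1} ∩ S
  have h_disjoint : Pairwise (Function.onFun Disjoint A) := fun r s hrs =>
    ((Set.disjoint_singleton.2 (Subtype.coe_ne_coe.2 hrs)).preimage v).mono
      Set.inter_subset_left Set.inter_subset_left
  have h_lintegral (m : Measure Plane) (F : ℝ≥0∞ → ℝ≥0∞) :
      ∫⁻ x in S, F (v x) ∂m = ∑ r : v.range, F r * m (A r) := by
    have := (v.map F).lintegral_eq_lintegral (m.restrict S)
    rw [SimpleFunc.map_lintegral, ← Finset.sum_coe_sort] at this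
    simpa only [SimpleFunc.coe_map, Function.comp_apply,
      Measure.restrict_apply (v.measurableSet_fiber _)] using this
  have h_v (ω : Ω) := h_lintegral (Φ.toMeasure ω) id
  simp only [id_eq] at h_v
  simp_rw [h_v, h_lintegral volume fun r => 1 - expNeg r]
  exact hΦ.lintegral_expNeg_sum_mul_toMeasure (fun _ => (v.measurableSet_fiber _).inter hS)
    (fun _ => hb.subset Set.inter_subset_right) h_disjoint _

theorem lintegral_expNeg_lintegral [IsFiniteMeasure μ] (hΦ : IsHPPP Φ lam μ)
    {u : Plane → ℝ≥0∞} (hu : Measurable u) :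
    ∫⁻ ω, expNeg (∫⁻ x, u x ∂Φ.toMeasure ω) ∂μ = expNeg (lam * ∫⁻ x, (1 - expNeg (u x))) := by
  let S : ℕ → Set Plane := fun n => Metric.ball 0 n
  let v : ℕ → SimpleFunc Plane ℝ≥0∞ := SimpleFunc.eapprox u
  have hS (n : ℕ) : MeasurableSet (S n) := measurableSet_ball
  have hS_mono : Monotone S := fun _ _ h => Metric.ball_subset_ball (Nat.cast_le.2 h)
  have hS_univ : ⋃ n, S n = Set.univ := Metric.iUnion_ball_nat 0
  have hv_mono : Monotone fun n => (v n : Plane → ℝ≥0∞) := SimpleFunc.monotone_eapprox u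
  have hv_lim (x : Plane) : Tendsto (fun n => v n x) atTop (𝓝 (u x)) :=
    SimpleFunc.tendsto_eapprox hu x
  have h_lhs := tendsto_lintegral_expNeg (μ := μ)
    (fun n => Φ.measurable_setLIntegral_toMeasure (hS n) (v n).measurable)
    fun ω => tendsto_setLIntegral_of_monotone (Φ.toMeasure ω) hS hS_mono hS_univ
      (fun n => (v n).measurable) hv_mono hv_lim
  have h_rhs := tendsto_setLIntegral_of_monotone volume hS hS_mono hS_univ
    (v := fun n x => 1 - expNeg (v n x)) (fun n => by fun_prop)
    (fun _ _ h x => tsub_le_tsub_left (antitone_expNeg (hv_mono h x)) 1)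
    fun x => ENNReal.Tendsto.sub tendsto_const_nhds
      ((continuous_expNeg.tendsto _).comp (hv_lim x)) (.inl ENNReal.one_ne_top)
  refine tendsto_nhds_unique h_lhs ?_
  simp only [hΦ.lintegral_expNeg_setLIntegral_simpleFunc (hS _) Metric.isBounded_ball]
  exact (continuous_expNeg.tendsto _).comp
    (ENNReal.Tendsto.const_mul h_rhs (.inr ENNReal.coe_ne_top))

end IsHPPP

/-- `Φ` is a homogeneous Poisson point process in the plane with density `lam`, whose points carry
independent marks `f k` with law `ν`, independent of `Φ`. -/
structure IsMarkedHPPP {Ω M : Type*} [MeasurableSpace Ω] [MeasurableSpace M]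
    (Φ : PointProcess Ω Plane) (lam : ℝ≥0) (f : ℕ → Ω → M) (ν : Measure M) (μ : Measure Ω) :
    Prop where
  isHPPP : IsHPPP Φ lam μ
  measurable_mark : ∀ k, Measurable (f k)
  hasLaw_mark : ∀ k, HasLaw (f k) ν μ
  iIndepFun_mark : iIndepFun f μ
  indepFun : IndepFun Φ.toRandomElement (fun ω k => f k ω) μ

namespace IsMarkedHPPP

variable {Ω M : Type*} [MeasurableSpace Ω] [MeasurableSpace M] {Φ : PointProcess Ω Plane}
  {lam : ℝ≥0} {f : ℕ → Ω → M} {ν : Measure M} {μ : Measure Ω} {u : Plane → M → ℝ≥0∞}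

lemma isProbabilityMeasure (hΦ : IsMarkedHPPP Φ lam f ν μ) : IsProbabilityMeasure μ :=
  hΦ.iIndepFun_mark.isProbabilityMeasure

lemma isProbabilityMeasure_mark (hΦ : IsMarkedHPPP Φ lam f ν μ) : IsProbabilityMeasure ν := by
  have := hΦ.isProbabilityMeasure
  rw [← (hΦ.hasLaw_mark 0).map_eq]
  exact Measure.isProbabilityMeasure_map (hΦ.measurable_mark 0).aemeasurable

lemma lintegral_mark (hΦ : IsMarkedHPPP Φ lam f ν μ) (k : ℕ) {F : M → ℝ≥0∞}
    (hF : Measurable F) : ∫⁻ ω, F (f k ω) ∂μ = ∫⁻ m, F m ∂ν := by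
  rw [← (hΦ.hasLaw_mark k).map_eq, lintegral_map hF (hΦ.measurable_mark k)]

lemma lintegral_expNeg_shotNoise_of_points (hΦ : IsMarkedHPPP Φ lam f ν μ)
    (hu : Measurable u.uncurry) (ω : Ω) :
    ∫⁻ z, expNeg (shotNoise u (Φ.toRandomElement ω, z)) ∂μ.map (fun ω k => f k ω)
      = expNeg (∫⁻ x, negLog (∫⁻ m, expNeg (u x m) ∂ν) ∂Φ.toMeasure ω) := by
  have := hΦ.isProbabilityMeasure_mark
  have := hΦ.isProbabilityMeasure
  let X (k : ℕ) (m : M) : ℝ≥0∞ := if (k : ℕ∞) < Φ.num ω then u (Φ.pt k ω) m else 0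
  have hX (k : ℕ) : Measurable (X k) :=
    Measurable.ite (.const _) (hu.comp measurable_prodMk_left) measurable_const
  have h_factor (k : ℕ) : negLog (∫⁻ ω', expNeg (X k (f k ω')) ∂μ)
      = if (k : ℕ∞) < Φ.num ω then negLog (∫⁻ m, expNeg (u (Φ.pt k ω) m) ∂ν) else 0 := by
    rw [hΦ.lintegral_mark k (F := fun m => expNeg (X k m)) (by fun_prop)]
    by_cases hk : (k : ℕ∞) < Φ.num ω <;> simp [X, hk]
  have h_shotNoise : Measurable fun z => expNeg (shotNoise u (Φ.toRandomElement ω, z)) :=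
    measurable_expNeg.comp ((measurable_shotNoise hu).comp measurable_prodMk_left)
  have h_negLog : Measurable fun x => negLog (∫⁻ m, expNeg (u x m) ∂ν) :=
    measurable_negLog.comp (measurable_expNeg.comp hu).lintegral_prod_right'
  rw [lintegral_map h_shotNoise (measurable_pi_lambda _ hΦ.measurable_mark),
    Φ.lintegral_toMeasure ω h_negLog]
  simp_rw [← h_factor]
  exact lintegral_expNeg_tsum_of_iIndepFun (fun k => (hX k).comp (hΦ.measurable_mark k))
    (hΦ.iIndepFun_mark.comp X hX)

theorem lintegral_expNeg_shotNoise (hΦ : IsMarkedHPPP Φ lam f ν μ) (hu : Measurable u.uncurry) :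
    ∫⁻ ω, expNeg (shotNoise u (Φ.marked f ω)) ∂μ
      = expNeg (lam * ∫⁻ x, ∫⁻ m, (1 - expNeg (u x m)) ∂ν) := by
  have := hΦ.isProbabilityMeasure_mark
  have := hΦ.isProbabilityMeasure
  have h_negLog : Measurable fun x => negLog (∫⁻ m, expNeg (u x m) ∂ν) :=
    measurable_negLog.comp (measurable_expNeg.comp hu).lintegral_prod_right'
  have h_one_sub (x : Plane) : 1 - expNeg (negLog (∫⁻ m, expNeg (u x m) ∂ν))
      = ∫⁻ m, (1 - expNeg (u x m)) ∂ν := by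
    have h_mark : Measurable fun m => expNeg (u x m) :=
      measurable_expNeg.comp (hu.comp measurable_prodMk_left)
    rw [expNeg_negLog (lintegral_expNeg_le_one _),
      lintegral_sub h_mark
        (ne_top_of_le_ne_top ENNReal.one_ne_top (lintegral_expNeg_le_one _))
        (ae_of_all _ fun m => expNeg_le_one _), lintegral_one, measure_univ]
  calc ∫⁻ ω, expNeg (shotNoise u (Φ.marked f ω)) ∂μ
    _ = ∫⁻ ω, expNeg (∫⁻ x, negLog (∫⁻ m, expNeg (u x m) ∂ν) ∂Φ.toMeasure ω) ∂μ := by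
      simp_rw [← hΦ.lintegral_expNeg_shotNoise_of_points hu]
      exact lintegral_prodMk_of_indepFun Φ.measurable_toRandomElement
        (measurable_pi_lambda _ hΦ.measurable_mark) hΦ.indepFun
        (measurable_expNeg.comp (measurable_shotNoise hu))
    _ = expNeg (lam * ∫⁻ x, ∫⁻ m, (1 - expNeg (u x m)) ∂ν) := by
      rw [hΦ.isHPPP.lintegral_expNeg_lintegral h_negLog]
      simp_rw [h_one_sub]

end IsMarkedHPPP

section Interference

/-- The power received at `b` from a transmitter at `x` with power `P` and fading gain `m`; the
shot noise of this response is the interference. -/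
noncomputable def receivedPower (P : ℝ≥0) (α : ℝ) (b x : Plane) (m : ℝ) : ℝ≥0∞ :=
  P * ENNReal.ofReal m * edist x b ^ (-α)

lemma measurable_receivedPower (P : ℝ≥0) (α : ℝ) (b : Plane) :
    Measurable (receivedPower P α b).uncurry := by
  unfold receivedPower Function.uncurry
  fun_prop

lemma lintegral_one_sub_expNeg_mul_receivedPower {α : ℝ} (hα : 2 < α) (P : ℝ≥0) (b : Plane)
    (ν : Measure ℝ) [SFinite ν] (s : ℝ≥0∞) :
    ∫⁻ x, ∫⁻ m, (1 - expNeg (s * receivedPower P α b x m)) ∂ν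
      = s ^ (2 / α) * (P ^ (2 / α) * ENNReal.ofReal (Real.pi * Real.Gamma (1 - 2 / α)) *
        ∫⁻ m, ENNReal.ofReal m ^ (2 / α) ∂ν) := by
  have hδ : 0 ≤ 2 / α := by positivity
  have h_points (m : ℝ) : ∫⁻ x, (1 - expNeg (s * receivedPower P α b x m))
      = s ^ (2 / α) * (P ^ (2 / α) * ENNReal.ofReal (Real.pi * Real.Gamma (1 - 2 / α)))
        * ENNReal.ofReal m ^ (2 / α) := by
    simp_rw [receivedPower, ← mul_assoc s (P * ENNReal.ofReal m)]
    have := lintegral_one_sub_expNeg_mul_edist_rpow volume (α := α) (by simpa using hα) b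
      (s * (P * ENNReal.ofReal m))
    rw [finrank_euclideanSpace_fin, EuclideanSpace.volume_ball_fin_two] at this
    simp only [Nat.cast_ofNat] at this
    rw [this, ENNReal.mul_rpow_of_nonneg _ _ hδ, ENNReal.mul_rpow_of_nonneg _ _ hδ,
      ENNReal.ofReal_mul Real.pi_nonneg]
    simp only [ENNReal.ofReal_one, one_pow, one_mul]
    ring
  have h_meas : Measurable fun p : Plane × ℝ => 1 - expNeg (s * receivedPower P α b p.1 p.2) :=
    measurable_const.sub (measurable_expNeg.comp ((measurable_receivedPower P α b).const_mul s))
  rw [lintegral_lintegral_swap h_meas.aemeasurable]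
  simp_rw [h_points]
  rw [lintegral_const_mul _ (by fun_prop), mul_assoc]

variable {Ω : Type*} [MeasurableSpace Ω] {Φ : PointProcess Ω Plane} {lam : ℝ≥0} {f : ℕ → Ω → ℝ}
  {ν : Measure ℝ} {μ : Measure Ω} {α : ℝ}

lemma interference_eq_shotNoise (P : ℝ≥0) (α : ℝ) (b : Plane) (Φ : PointProcess Ω Plane)
    (f : ℕ → Ω → ℝ) (ω : Ω) :
    interference P α b Φ f ω = shotNoise (receivedPower P α b) (Φ.marked f ω) := rfl

lemma measurable_interference (P : ℝ≥0) (α : ℝ) (b : Plane) (Φ : PointProcess Ω Plane)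
    (hf : ∀ k, Measurable (f k)) : Measurable (interference P α b Φ f) :=
  (measurable_shotNoise (measurable_receivedPower P α b)).comp (Φ.measurable_marked hf)

lemma lintegral_expNeg_mul_interference (hΦ : IsMarkedHPPP Φ lam f ν μ) (hα : 2 < α) (P : ℝ≥0)
    (b : Plane) (s : ℝ≥0∞) :
    ∫⁻ ω, expNeg (s * interference P α b Φ f ω) ∂μ
      = expNeg (lam * (s ^ (2 / α) * (P ^ (2 / α) *
        ENNReal.ofReal (Real.pi * Real.Gamma (1 - 2 / α)) *
        ∫⁻ m, ENNReal.ofReal m ^ (2 / α) ∂ν))) := by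
  have := hΦ.isProbabilityMeasure_mark
  simp_rw [interference_eq_shotNoise, const_mul_shotNoise]
  rw [hΦ.lintegral_expNeg_shotNoise (u := fun x m => s * receivedPower P α b x m)
      ((measurable_receivedPower P α b).const_mul s),
    lintegral_one_sub_expNeg_mul_receivedPower hα]

lemma ae_interference_lt_top (hΦ : IsMarkedHPPP Φ lam f ν μ) (hα : 2 < α)
    (hν : ∫⁻ m, ENNReal.ofReal m ^ (2 / α) ∂ν ≠ ∞) (P : ℝ≥0) (b : Plane) :
    ∀ᵐ ω ∂μ, interference P α b Φ f ω < ∞ := by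
  have := hΦ.isProbabilityMeasure
  refine ae_lt_top_of_tendsto_lintegral_expNeg_mul
    (measurable_interference P α b Φ hΦ.measurable_mark) ?_
  simp_rw [lintegral_expNeg_mul_interference hΦ hα]
  set C : ℝ≥0∞ := P ^ (2 / α) * ENNReal.ofReal (Real.pi * Real.Gamma (1 - 2 / α)) *
    ∫⁻ m, ENNReal.ofReal m ^ (2 / α) ∂ν
  have hC : C ≠ ∞ := ENNReal.mul_ne_top (ENNReal.mul_ne_top
    (ENNReal.rpow_ne_top_of_nonneg (by positivity) ENNReal.coe_ne_top) ENNReal.ofReal_ne_top) hν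
  have h_lim : Tendsto (fun s : ℝ≥0∞ => lam * (s ^ (2 / α) * C)) (𝓝 0) (𝓝 0) := by
    have h_rpow := (ENNReal.continuous_rpow_const (y := 2 / α)).tendsto 0
    rw [ENNReal.zero_rpow_of_pos (by positivity)] at h_rpow
    simpa using ENNReal.Tendsto.const_mul
      (ENNReal.Tendsto.mul_const h_rpow (.inr hC)) (.inr ENNReal.coe_ne_top)
  simpa [Function.comp_def] using
    ((continuous_expNeg.tendsto 0).comp h_lim).mono_left nhdsWithin_le_nhds

lemma lintegral_expNeg_mul_interference_of_expMeasure
    (hΦ : IsMarkedHPPP Φ lam f (expMeasure 1) μ) (hα : 2 < α) (P : ℝ≥0) (b : Plane) {s : ℝ}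
    (hs : 0 ≤ s) :
    ∫⁻ ω, expNeg (ENNReal.ofReal s * interference P α b Φ f ω) ∂μ
      = ENNReal.ofReal (Real.exp (-(Real.pi * ((P : ℝ) ^ (2 / α) * lam) *
        ((2 * Real.pi / α) / Real.sin (2 * Real.pi / α)) * s ^ (2 / α)))) := by
  have hα0 : 0 < α := by linarith
  have hδ : 0 < 2 / α := by positivity
  have hΓ : 0 < Real.Gamma (1 - 2 / α) :=
    Real.Gamma_pos_of_pos (sub_pos.2 ((div_lt_one hα0).2 hα))
  have h_reflection := Gamma_add_one_mul_Gamma_one_sub hδ.ne'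
  rw [← mul_div_assoc, mul_comm Real.pi 2] at h_reflection
  rw [lintegral_expNeg_mul_interference hΦ hα, lintegral_rpow_expMeasure one_pos (by linarith),
    ENNReal.ofReal_rpow_of_nonneg hs hδ.le, ← ENNReal.ofReal_coe_nnreal,
    ← ENNReal.ofReal_coe_nnreal, ENNReal.ofReal_rpow_of_nonneg P.coe_nonneg hδ.le,
    ← ENNReal.ofReal_mul (by positivity), ← ENNReal.ofReal_mul (by positivity),
    ← ENNReal.ofReal_mul (by positivity),
    ← ENNReal.ofReal_mul (by positivity), expNeg_ofReal (by positivity), ← h_reflection,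
    Real.one_rpow]
  congr 3
  ring

lemma ae_interference_lt_top_of_expMeasure (hΦ : IsMarkedHPPP Φ lam f (expMeasure 1) μ)
    (hα : 2 < α) (P : ℝ≥0) (b : Plane) : ∀ᵐ ω ∂μ, interference P α b Φ f ω < ∞ := by
  have hδ : 0 < 2 / α := by positivity
  refine ae_interference_lt_top hΦ hα ?_ P b
  rw [lintegral_rpow_expMeasure one_pos (by linarith)]
  exact ENNReal.ofReal_ne_top

lemma lintegral_expNeg_mul_noise_add_interference {lamI : ℝ≥0} {ΦI : PointProcess Ω Plane}
    {g : ℕ → Ω → ℝ} (hΦ : IsMarkedHPPP Φ lam f (expMeasure 1) μ)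
    (hΦI : IsMarkedHPPP ΦI lamI g (expMeasure 1) μ)
    (h_indep : IndepFun (Φ.marked f) (ΦI.marked g) μ) (hα : 2 < α) (PN PI : ℝ≥0) (b : Plane)
    {s : ℝ} (hs : 0 ≤ s) :
    ∫⁻ ω, expNeg (ENNReal.ofReal s *
        (PN + interference 1 α b Φ f ω + interference PI α b ΦI g ω)) ∂μ
      = ENNReal.ofReal
        (Real.exp (-(s * PN + interferenceCoeff lam lamI PI α * s ^ (2 / α)))) := by
  have h_indep' : IndepFun (interference 1 α b Φ f) (interference PI α b ΦI g) μ :=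
    h_indep.comp (measurable_shotNoise (measurable_receivedPower 1 α b))
      (measurable_shotNoise (measurable_receivedPower PI α b))
  have h_laplace : Measurable fun x => expNeg (ENNReal.ofReal s * x) := by fun_prop
  have h_prod := lintegral_mul_eq_lintegral_mul_lintegral_of_indepFun
    (h_laplace.comp (measurable_interference 1 α b Φ hΦ.measurable_mark))
    (h_laplace.comp (measurable_interference PI α b ΦI hΦI.measurable_mark))
    (h_indep'.comp h_laplace h_laplace)
  simp only [Pi.mul_apply, Function.comp_apply] at h_prod
  simp_rw [mul_add, expNeg_add, mul_assoc]
  rw [lintegral_const_mul' _ _ (expNeg_ne_top _), h_prod,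
    lintegral_expNeg_mul_interference_of_expMeasure hΦ hα 1 b hs,
    lintegral_expNeg_mul_interference_of_expMeasure hΦI hα PI b hs, ← ENNReal.ofReal_coe_nnreal,
    ← ENNReal.ofReal_mul hs, expNeg_ofReal (by positivity), ← ENNReal.ofReal_mul (by positivity),
    ← ENNReal.ofReal_mul (by positivity), ← Real.exp_add, ← Real.exp_add, interferenceCoeff,
    NNReal.coe_one, Real.one_rpow]
  congr 2
  ring

end Interference

section ExponentialFading

lemma le_mul_rpow_neg_div_iff {τ a ρ d : ℝ≥0∞} {α : ℝ} (hα : 0 < α) (hρ : ρ ≠ ∞) (hd : d ≠ ∞)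
    (ha : a ≠ 0) (ha' : a ≠ ∞) : τ ≤ a * ρ ^ (-α) / d ↔ τ * ρ ^ α * d ≤ a := by
  rcases eq_or_ne ρ 0 with rfl | hρ0
  · simp [ENNReal.zero_rpow_of_neg (neg_neg_of_pos hα), ENNReal.zero_rpow_of_pos hα,
      ENNReal.mul_top ha, ENNReal.top_div_of_ne_top hd]
  have h_zero : ρ ^ α ≠ 0 := by simp [ENNReal.rpow_eq_zero_iff, hρ0, hρ]
  have h_top : ρ ^ α ≠ ∞ := ENNReal.rpow_ne_top_of_nonneg hα.le hρ
  have h_signal : a * (ρ ^ α)⁻¹ ≠ 0 := mul_ne_zero ha (ENNReal.inv_ne_zero.2 h_top)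
  have h_signal' : a * (ρ ^ α)⁻¹ ≠ ∞ := ENNReal.mul_ne_top ha' (ENNReal.inv_ne_top.2 h_zero)
  rw [ENNReal.rpow_neg, ENNReal.le_div_iff_mul_le (.inr h_signal) (.inr h_signal'),
    ← div_eq_mul_inv, ENNReal.le_div_iff_mul_le (.inl h_zero) (.inl h_top), mul_right_comm]

variable {Ω : Type*} [MeasurableSpace Ω] {μ : Measure Ω} [IsFiniteMeasure μ] {r : ℝ}
  {h : Ω → ℝ} {D : Ω → ℝ≥0∞}

lemma measure_le_ofReal_of_indepFun (hr : 0 < r) (hh : Measurable h)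
    (hh_law : HasLaw h (expMeasure r) μ) (hD : Measurable D) (h_indep : IndepFun D h μ) :
    μ {ω | D ω ≤ ENNReal.ofReal (h ω)} = ∫⁻ ω, expNeg (ENNReal.ofReal r * D ω) ∂μ := by
  have hS : MeasurableSet {p : ℝ≥0∞ × ℝ | p.1 ≤ ENNReal.ofReal p.2} :=
    measurableSet_le (by fun_prop) (by fun_prop)
  have h_fubini := lintegral_prodMk_of_indepFun hD hh h_indep (measurable_one.indicator hS)
  rw [hh_law.map_eq] at h_fubini
  calc μ {ω | D ω ≤ ENNReal.ofReal (h ω)}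
    _ = ∫⁻ ω, {p : ℝ≥0∞ × ℝ | p.1 ≤ ENNReal.ofReal p.2}.indicator 1 (D ω, h ω) ∂μ :=
      (lintegral_indicator_one (hD.prodMk hh hS)).symm
    _ = ∫⁻ ω, expMeasure r {x | D ω ≤ ENNReal.ofReal x} ∂μ :=
      h_fubini.trans (lintegral_congr fun ω =>
        lintegral_indicator_one (measurable_prodMk_left (x := D ω) hS))
    _ = ∫⁻ ω, expNeg (ENNReal.ofReal r * D ω) ∂μ := by
      simp_rw [expMeasure_setOf_le_ofReal hr]

lemma measure_le_mul_rpow_neg_div (hr : 0 < r) (hh : Measurable h)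
    (hh_law : HasLaw h (expMeasure r) μ) (hD : Measurable D) (hD_top : ∀ᵐ ω ∂μ, D ω < ∞)
    (h_indep : IndepFun D h μ) {τ ρ : ℝ≥0∞} {α : ℝ} (hα : 0 < α) (hρ : ρ ≠ ∞) :
    μ {ω | τ ≤ ENNReal.ofReal (h ω) * ρ ^ (-α) / D ω}
      = ∫⁻ ω, expNeg (ENNReal.ofReal r * (τ * ρ ^ α * D ω)) ∂μ := by
  have h_pos : ∀ᵐ ω ∂μ, 0 < h ω :=
    ae_of_ae_map hh.aemeasurable (hh_law.map_eq ▸ ae_pos_expMeasure hr)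
  have h_threshold : {ω | τ ≤ ENNReal.ofReal (h ω) * ρ ^ (-α) / D ω}
      =ᵐ[μ] {ω | τ * ρ ^ α * D ω ≤ ENNReal.ofReal (h ω)} := by
    filter_upwards [h_pos, hD_top] with ω hω hDω
    exact propext (le_mul_rpow_neg_div_iff hα hρ hDω.ne (by simpa using hω) ENNReal.ofReal_ne_top)
  rw [measure_congr h_threshold]
  exact measure_le_ofReal_of_indepFun hr hh hh_law (hD.const_mul _)
    (h_indep.comp (measurable_const_mul _) measurable_id)

lemma condProb_le_mul_rpow_neg_div (hr : 0 < r) (hh : Measurable h)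
    (hh_law : HasLaw h (expMeasure r) μ) (hD : Measurable D) (hD_top : ∀ᵐ ω ∂μ, D ω < ∞)
    (h_indep : IndepFun D h μ) {R : Ω → ℝ} (hR : Measurable R)
    (hR_indep : IndepFun R (fun ω => (h ω, D ω)) μ) (τ : ℝ≥0∞) {α : ℝ} (hα : 0 < α) :
    μ⟦{ω | τ ≤ ENNReal.ofReal (h ω) * ENNReal.ofReal (R ω) ^ (-α) / D ω} |
        MeasurableSpace.comap R inferInstance⟧
      =ᵐ[μ] fun ω => (∫⁻ ω', expNeg (ENNReal.ofReal r *
        (τ * ENNReal.ofReal (R ω) ^ α * D ω')) ∂μ).toReal := by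
  have hS : MeasurableSet {p : ℝ × ℝ × ℝ≥0∞ |
      τ ≤ ENNReal.ofReal p.2.1 * ENNReal.ofReal p.1 ^ (-α) / p.2.2} :=
    measurableSet_le (by fun_prop) (by fun_prop)
  refine (condProb_ae_eq_of_indepFun hR (hh.prodMk hD) hR_indep hS).trans (ae_of_all _ fun ω => ?_)
  exact congrArg ENNReal.toReal (measure_le_mul_rpow_neg_div hr hh hh_law hD hD_top h_indep hα
    ENNReal.ofReal_ne_top)

end ExponentialFading

section SINR

variable {Ω : Type*} [MeasurableSpace Ω] {μ : Measure Ω} {lam lamI : ℝ≥0} {y : Ω → Plane}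
  {h : Ω → ℝ} {Φ ΦI : PointProcess Ω Plane} {f g : ℕ → Ω → ℝ}

theorem condProb_le_sinr (hΦ : IsMarkedHPPP Φ lam f (expMeasure 1) μ)
    (hΦI : IsMarkedHPPP ΦI lamI g (expMeasure 1) μ) (hy : Measurable y) (hh : Measurable h)
    (hh_law : HasLaw h (expMeasure 1) μ) (h_indep : IndepFun (Φ.marked f) (ΦI.marked g) μ)
    (hh_indep : IndepFun (fun ω => (Φ.marked f ω, ΦI.marked g ω)) h μ)
    (hy_indep : IndepFun y (fun ω => (h ω, Φ.marked f ω, ΦI.marked g ω)) μ)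
    {α : ℝ} (hα : 2 < α) (PN PI τ : ℝ≥0) (b : Plane) :
    μ⟦{ω | (τ : ℝ≥0∞) ≤ sinr PN PI α b y h Φ f ΦI g ω} |
        MeasurableSpace.comap (fun ω => dist (y ω) b) inferInstance⟧
      =ᵐ[μ] fun ω => Real.exp (-(τ * dist (y ω) b ^ α * PN +
        interferenceCoeff lam lamI PI α * (τ : ℝ) ^ (2 / α) * dist (y ω) b ^ 2)) := by
  have := hΦ.isProbabilityMeasure
  have hα0 : 0 < α := by linarith
  let D (p : ((ℕ∞ × (ℕ → Plane)) × (ℕ → ℝ)) × ((ℕ∞ × (ℕ → Plane)) × (ℕ → ℝ))) : ℝ≥0∞ :=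
    PN + shotNoise (receivedPower 1 α b) p.1 + shotNoise (receivedPower PI α b) p.2
  have hD : Measurable D :=
    (((measurable_shotNoise (measurable_receivedPower 1 α b)).comp measurable_fst).const_add _).add
      ((measurable_shotNoise (measurable_receivedPower PI α b)).comp measurable_snd)
  have hD_meas : Measurable fun ω => D (Φ.marked f ω, ΦI.marked g ω) := hD.comp
    ((Φ.measurable_marked hΦ.measurable_mark).prodMk (ΦI.measurable_marked hΦI.measurable_mark))
  have hD_top : ∀ᵐ ω ∂μ, D (Φ.marked f ω, ΦI.marked g ω) < ∞ := by
    filter_upwards [ae_interference_lt_top_of_expMeasure hΦ hα 1 b,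
      ae_interference_lt_top_of_expMeasure hΦI hα PI b] with ω hI hJ
    exact ENNReal.add_lt_top.2 ⟨ENNReal.add_lt_top.2 ⟨ENNReal.coe_lt_top, hI⟩, hJ⟩
  have h_dist : Measurable fun x : Plane => dist x b := by fun_prop
  have h_cond := condProb_le_mul_rpow_neg_div (R := fun ω => dist (y ω) b) one_pos hh hh_law
    hD_meas hD_top (hh_indep.comp hD measurable_id) (h_dist.comp hy)
    (hy_indep.comp h_dist (measurable_fst.prodMk (hD.comp measurable_snd))) τ hα0
  simp_rw [sinr, edist_dist]
  filter_upwards [h_cond] with ω hω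
  have hs : (τ : ℝ≥0∞) * ENNReal.ofReal (dist (y ω) b) ^ α
      = ENNReal.ofReal (τ * dist (y ω) b ^ α) := by
    rw [ENNReal.ofReal_mul τ.coe_nonneg, ENNReal.ofReal_coe_nnreal,
      ENNReal.ofReal_rpow_of_nonneg dist_nonneg hα0.le]
  have hs_pow : (τ * dist (y ω) b ^ α) ^ (2 / α) = (τ : ℝ) ^ (2 / α) * dist (y ω) b ^ 2 := by
    rw [Real.mul_rpow τ.coe_nonneg (by positivity), ← Real.rpow_mul dist_nonneg,
      mul_div_cancel₀ _ hα0.ne', Real.rpow_two]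
  refine hω.trans ?_
  simp_rw [ENNReal.ofReal_one, one_mul, hs]
  refine (congrArg ENNReal.toReal (lintegral_expNeg_mul_noise_add_interference hΦ hΦI h_indep hα
    PN PI b (by positivity))).trans ?_
  rw [ENNReal.toReal_ofReal (Real.exp_nonneg _), hs_pow, mul_assoc (interferenceCoeff _ _ _ _)]

lemma indepFun_marked_of_iIndep {β γ E M : Type*} [MeasurableSpace β]
    [MeasurableSpace γ] [MeasurableSpace E] [MeasurableSpace M] {y : Ω → β} {h : Ω → γ}
    {Φ ΦI : PointProcess Ω E} {f g : ℕ → Ω → M} (hy : Measurable y) (hh : Measurable h)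
    (hf : ∀ k, Measurable (f k)) (hg : ∀ k, Measurable (g k))
    (h_indep : iIndep
      ![MeasurableSpace.comap y inferInstance,
        MeasurableSpace.comap h inferInstance,
        MeasurableSpace.comap Φ.toRandomElement inferInstance,
        MeasurableSpace.comap (fun ω k => f k ω) inferInstance,
        MeasurableSpace.comap ΦI.toRandomElement inferInstance,
        MeasurableSpace.comap (fun ω k => g k ω) inferInstance] μ) :
    IndepFun (Φ.marked f) (ΦI.marked g) μ ∧
    IndepFun (fun ω => (Φ.marked f ω, ΦI.marked g ω)) h μ ∧
    IndepFun y (fun ω => (h ω, Φ.marked f ω, ΦI.marked g ω)) μ := by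
  set m : Fin 6 → MeasurableSpace Ω :=
    ![MeasurableSpace.comap y inferInstance,
      MeasurableSpace.comap h inferInstance,
      MeasurableSpace.comap Φ.toRandomElement inferInstance,
      MeasurableSpace.comap (fun ω k => f k ω) inferInstance,
      MeasurableSpace.comap ΦI.toRandomElement inferInstance,
      MeasurableSpace.comap (fun ω k => g k ω) inferInstance]
  have hm (i : Fin 6) : m i ≤ ‹MeasurableSpace Ω› := by
    fin_cases i
    exacts [hy.comap_le, hh.comap_le, Φ.measurable_toRandomElement.comap_le,
      (measurable_pi_lambda _ hf).comap_le, ΦI.measurable_toRandomElement.comap_le,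
      (measurable_pi_lambda _ hg).comap_le]
  have h_y : Measurable[m 0] y := comap_measurable _
  have h_h : Measurable[m 1] h := comap_measurable _
  have h_Φ : Measurable[m 2] Φ.toRandomElement := comap_measurable _
  have h_f : Measurable[m 3] fun ω k => f k ω := comap_measurable _
  have h_ΦI : Measurable[m 4] ΦI.toRandomElement := comap_measurable _
  have h_g : Measurable[m 5] fun ω k => g k ω := comap_measurable _
  have h_gain {T : Set (Fin 6)} (hT : 1 ∈ T) : Measurable[⨆ i ∈ T, m i] h :=
    h_h.mono (le_biSup m hT) le_rfl
  have h_marked {T : Set (Fin 6)} (hT : {2, 3} ⊆ T) : Measurable[⨆ i ∈ T, m i] (Φ.marked f) :=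
    Measurable.prodMk (h_Φ.mono (le_biSup m (hT (by simp))) le_rfl)
      (h_f.mono (le_biSup m (hT (by simp))) le_rfl)
  have h_markedI {T : Set (Fin 6)} (hT : {4, 5} ⊆ T) : Measurable[⨆ i ∈ T, m i] (ΦI.marked g) :=
    Measurable.prodMk (h_ΦI.mono (le_biSup m (hT (by simp))) le_rfl)
      (h_g.mono (le_biSup m (hT (by simp))) le_rfl)
  refine ⟨?_, ?_, ?_⟩
  · exact indepFun_of_iIndep_of_disjoint hm h_indep (S := {2, 3}) (T := {4, 5}) (by simp)
      (h_marked subset_rfl) (h_markedI subset_rfl)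
  · exact indepFun_of_iIndep_of_disjoint hm h_indep (S := {2, 3, 4, 5}) (T := {1}) (by simp)
      ((h_marked (by grind)).prodMk (h_markedI (by grind))) (h_gain rfl)
  · exact indepFun_of_iIndep_of_disjoint hm h_indep (S := {0}) (T := {1, 2, 3, 4, 5}) (by simp)
      (h_y.mono (le_biSup m rfl) le_rfl)
      ((h_gain (by simp)).prodMk ((h_marked (by grind)).prodMk (h_markedI (by grind))))

lemma tendsto_rpow_two_div_mul_atTop {P : ℝ} (hP : P ≠ 0) (c : ℝ) :
    Tendsto (fun a : ℝ => P ^ (2 / a) * c) atTop (𝓝 c) := by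
  have h_div : Tendsto (fun a : ℝ => 2 / a) atTop (𝓝 0) :=
    tendsto_const_nhds.div_atTop tendsto_id
  simpa using ((Real.continuousAt_const_rpow hP).tendsto.comp h_div).mul_const c

end SINR

theorem theorem1 {Ω : Type*} [MeasurableSpace Ω] (μ : Measure Ω) [IsProbabilityMeasure μ]
    (lam lamI PI τ : ℝ≥0) (α : ℝ) (hα : 2 < α)
    -- receiver, random location of the device, and its fading gain
    (b : Plane) (y : Ω → Plane) (hy : Measurable y)
    (h : Ω → ℝ) (hh : Measurable h) (hh_law : HasLaw h (expMeasure 1) μ)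
    -- interfering IoT devices and their fading gains
    (Φ : PointProcess Ω Plane) (hΦ : IsHPPP Φ lam μ)
    (f : ℕ → Ω → ℝ) (hf : ∀ k, Measurable (f k)) (hf_law : ∀ k, HasLaw (f k) (expMeasure 1) μ)
    (hf_indep : iIndepFun f μ)
    -- incumbents on the band and their fading gains
    (ΦI : PointProcess Ω Plane) (hΦI : IsHPPP ΦI lamI μ)
    (g : ℕ → Ω → ℝ) (hg : ∀ k, Measurable (g k)) (hg_law : ∀ k, HasLaw (g k) (expMeasure 1) μ)
    (hg_indep : iIndepFun g μ)
    -- the location, the gain, the two point processes and the two gain sequences are independent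
    (h_indep : iIndep
      ![MeasurableSpace.comap y inferInstance,
        MeasurableSpace.comap h inferInstance,
        MeasurableSpace.comap Φ.toRandomElement inferInstance,
        MeasurableSpace.comap (fun ω k => f k ω) inferInstance,
        MeasurableSpace.comap ΦI.toRandomElement inferInstance,
        MeasurableSpace.comap (fun ω k => g k ω) inferInstance] μ) :
    -- without noise
    (μ⟦{ω | (τ : ℝ≥0∞) ≤ sinr 0 PI α b y h Φ f ΦI g ω} |
        MeasurableSpace.comap (fun ω => dist (y ω) b) inferInstance⟧
      =ᵐ[μ] fun ω => Real.exp
        (-(interferenceCoeff lam lamI PI α * (τ : ℝ) ^ (2 / α) * dist (y ω) b ^ 2))) ∧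
    -- in the limit of vanishing noise
    (∀ PN : ℕ → ℝ≥0, Tendsto PN atTop (𝓝 0) → ∀ᵐ ω ∂μ,
      Tendsto (fun n => (μ⟦{ω | (τ : ℝ≥0∞) ≤ sinr (PN n) PI α b y h Φ f ΦI g ω} |
          MeasurableSpace.comap (fun ω => dist (y ω) b) inferInstance⟧) ω) atTop
        (𝓝 (Real.exp
          (-(interferenceCoeff lam lamI PI α * (τ : ℝ) ^ (2 / α) * dist (y ω) b ^ 2))))) ∧
    -- for a large path-loss exponent the power of the incumbents becomes irrelevant
    (0 < PI → Tendsto (fun a : ℝ => (PI : ℝ) ^ (2 / a) * (lamI : ℝ)) atTop (𝓝 (lamI : ℝ))) := by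
  have hΦ_marked : IsMarkedHPPP Φ lam f (expMeasure 1) μ :=
    ⟨hΦ, hf, hf_law, hf_indep, h_indep.indep (show (2 : Fin 6) ≠ 3 by decide)⟩
  have hΦI_marked : IsMarkedHPPP ΦI lamI g (expMeasure 1) μ :=
    ⟨hΦI, hg, hg_law, hg_indep, h_indep.indep (show (4 : Fin 6) ≠ 5 by decide)⟩
  obtain ⟨h_marked_indep, hh_indep, hy_indep⟩ := indepFun_marked_of_iIndep hy hh hf hg h_indep
  have h_cond (PN : ℝ≥0) := condProb_le_sinr hΦ_marked hΦI_marked hy hh hh_law h_marked_indep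
    hh_indep hy_indep hα PN PI τ b
  refine ⟨by simpa using h_cond 0, fun PN hPN => ?_, fun hPI => ?_⟩
  · filter_upwards [ae_all_iff.2 fun n => h_cond (PN n)] with ω hω
    simp_rw [hω]
    have h_noise := ((NNReal.tendsto_coe.2 hPN).const_mul ((τ : ℝ) * dist (y ω) b ^ α)).add_const
      (interferenceCoeff lam lamI PI α * (τ : ℝ) ^ (2 / α) * dist (y ω) b ^ 2)
    simpa using h_noise.neg.rexp
  · exact tendsto_rpow_two_div_mul_atTop (NNReal.coe_ne_zero.2 hPI.ne') lamI
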